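/- A graded poset is a finite partially ordered set $P$ with a minimum $\hat 0$, a maximum $\hat 1$ and a rank function $\rho:P\to\mathbb N$ such that $\rho(\hat 0)=0$ and $\rho(y)-\rho(x)=1$ whenever $y$ covers $x$; its rank is $\rho(\hat 1)$. For a graded poset $P$ of rank $n+1$ and $S\subseteq[1,n]=\{1,\dots,n\}$, let $f_S(P)$ be the number of chains $x_1<\cdots<x_{|S|}$ in $P$ with $\{\rho(x_1),\dots,\rho(x_{|S|})\}=S$; the flag vector of $P$ is $(f_S(P))_{S\subseteq[1,n]}\in\mathbb Q^{2^n}$. For a positive integer $r$, a poset is $r$-thick if every nonempty open interval $(x,y)=\{z: x<z<y\}$ has at least $r$ elements. Let $\mathcal C_{r,n+1}\subseteq\mathbb Q^{2^n}$ be the smallest closed convex cone (with respect to rational scalars and the usual topology of $\mathbb Q^{2^n}$) containing the flag vectors of all $r$-thick graded posets of rank $n+1$. Let $n\ge 0$ be an integer. For all positive integers $q$ and $r$, the linear map $\alpha_{q,r}:\mathbb Q^{2^n}\to\mathbb Q^{2^n}$, $\alpha_{q,r}\big((x_S)_{S\subseteq[1,n]}\big)=\big((r/q)^{|S|}x_S\big)_{S\subseteq[1,n]}$,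 is invertible and maps $\mathcal C_{q,n+1}$ onto $\mathcal C_{r,n+1}$, i.e. $\alpha_{q,r}(\mathcal C_{q,n+1})=\mathcal C_{r,n+1}$. -/

import Mathlib

namespace FlagCone

/-- A poset is `r`-thick if every nonempty open interval has at least `r` elements
(only used for finite posets, where `Set.ncard` is the number of elements). -/
def IsThick (r : ℕ) (P : Type) [PartialOrder P] : Prop :=
  ∀ x y : P, (Set.Ioo x y).Nonempty → r ≤ (Set.Ioo x y).ncard

/-- `f_S(P)`: the number of chains of `P` whose set of ranks is `S`.  (Distinct elements of a
chain have distinct ranks, so such a chain has exactly `|S|` elements.) -/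
noncomputable def flagNumber (P : Type) [PartialOrder P] [GradeMinOrder ℕ P]
    (S : Finset ℕ) : ℕ :=
  {C : Set P | IsChain (· ≤ ·) C ∧ grade ℕ '' C = (S : Set ℕ)}.ncard

/-- The space `ℚ^(2^n)`, with coordinates indexed by the subsets `S ⊆ [1,n]`. -/
abbrev FlagSpace (n : ℕ) : Type := (Finset.Icc 1 n).powerset → ℚ

/-- The flag `f`-vector `(f_S(P) : S ⊆ [1,n])`. -/
noncomputable def flagVector (n : ℕ) (P : Type) [PartialOrder P] [GradeMinOrder ℕ P] :
    FlagSpace n :=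
  fun S => (flagNumber P S.1 : ℚ)

/-- The set of flag vectors of all `r`-thick graded posets of rank `n + 1`.  A graded poset is a
finite poset with a minimum and a maximum and with a rank function that is `0` at the minimum and
increases by one along every covering relation (`GradeMinOrder ℕ`).  Finite posets all have
isomorphic copies in `Type`. -/
def thickFlagVectors (r n : ℕ) : Set (FlagSpace n) :=
  {v | ∃ (P : Type) (_ : PartialOrder P) (_ : BoundedOrder P) (_ : Finite P)
      (_ : GradeMinOrder ℕ P),
      grade ℕ (⊤ : P) = n + 1 ∧ IsThick r P ∧ v = flagVector n P}

/-- The smallest closed convex cone of `ℚ^(2^n)` containing the flag vectors of all `r`-thick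
graded posets of rank `n + 1`: the intersection of all closed convex cones containing them. -/
noncomputable def thickCone (r n : ℕ) : ConvexCone ℚ (FlagSpace n) :=
  sInf {C : ConvexCone ℚ (FlagSpace n) |
    IsClosed (C : Set (FlagSpace n)) ∧ thickFlagVectors r n ⊆ (C : Set (FlagSpace n))}

/-- The linear map `(x_S) ↦ ((r/q)^|S| x_S)`. -/
def alpha (n q r : ℕ) : FlagSpace n →ₗ[ℚ] FlagSpace n where
  toFun x S := ((r : ℚ) / (q : ℚ)) ^ S.1.card * x S
  map_add' x y := by
    funext S
    simp [mul_add]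
  map_smul' c x := by
    funext S
    simp [mul_left_comm]

end FlagCone

/-! For a family `F` of rank intervals, consider the vector whose value at `S` is `r ^ |S|` if `S`
meets every open interval of `F`, and `0` otherwise. Such vectors link all the cones, since `alpha n
q r` only replaces `q ^ |S|` by `r ^ |S|` in them. They lie in the cone of `r`: give each interval
of `F` a coordinate with `N + 1` values and each single rank one with `r` values. The resulting
`ColorPoset` is `r`-thick, its flag numbers are products (`ColorPoset.flagNumber_eq`), and after
division by `(N + 1) ^ |F|` the limit `N → ∞` is the desired vector (`blockerVector_mem`).
Conversely, let `P` be `q`-thick and order its elements by an injection into `ℕ`. A chain with rank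
set `S` is completed from the bottom up, choosing each missing element among the first `q` atoms of
the interval up to the next prescribed element. This gives `q ^ (n - |S|) * f_S(P)` maximal chains
(`ncard_isEarlyChain`). Shrinking an interval keeps early atoms early, so a maximal chain arises
from `S` exactly when `S` meets all its late intervals (`isEarlyChain_iff`), a family that does not
depend on `S`. Summing over maximal chains writes the rescaled flag vector as a positive combination
of the vectors above (`exists_flagNumber_eq_sum`). Hence `alpha n q r` sends the cone of `q` into
the cone of `r`, and its inverse `alpha n r q` gives the other inclusion. -/

namespace FlagCone

/-! ### Thick posets with product flag numbers. -/

/-- The elements `(i, p)` of the poset attached to a family of subsets `I j` of the ranks with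
multiplicities `w j`: `i` is the rank, and the coordinate `p j` is free exactly when `i ∈ I j`. -/
def ColorPoset {J : Type} (n : ℕ) (I : J → Set ℕ) (w : J → ℕ) : Type :=
  {x : ℕ × (J → ℕ) // x.1 ≤ n + 1 ∧ ∀ j, x.2 j < w j ∧ (x.1 ∉ I j → x.2 j = 0)}

namespace ColorPoset

variable {J : Type} {n : ℕ} {I : J → Set ℕ} {w : J → ℕ}

theorem ext_of_agree {x y : ColorPoset n I w} (h : x.1.1 = y.1.1)
    (hp : ∀ j, x.1.1 ∈ I j → y.1.1 ∈ I j → x.1.2 j = y.1.2 j) : x = y := by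
  apply Subtype.ext
  refine Prod.ext h (funext fun j => ?_)
  by_cases hj : x.1.1 ∈ I j
  · exact hp j hj (h ▸ hj)
  · rw [(x.2.2 j).2 hj, (y.2.2 j).2 (h ▸ hj)]

instance finite [Finite J] : Finite (ColorPoset n I w) := by
  have h : ({x : ℕ × (J → ℕ) | x.1 ≤ n + 1 ∧ ∀ j, x.2 j < w j ∧ (x.1 ∉ I j → x.2 j = 0)}).Finite := by
    refine ((Set.finite_Iic (n + 1)).prod
      (Set.Finite.pi' (ι := J) (t := fun j => Set.Iio (w j)) fun j => Set.finite_Iio _)).subset ?_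
    rintro x ⟨h1, h2⟩
    exact ⟨h1, fun j => (h2 j).1⟩
  exact h.to_subtype

/-- Elements are comparable when their coordinates agree wherever both are free. -/
@[reducible] def partialOrder (hI : ∀ j, (I j).OrdConnected) : PartialOrder (ColorPoset n I w) where
  le x y := x.1.1 ≤ y.1.1 ∧ ∀ j, x.1.1 ∈ I j → y.1.1 ∈ I j → x.1.2 j = y.1.2 j
  le_refl x := ⟨le_rfl, fun _ _ _ => rfl⟩
  le_trans x y z hxy hyz := ⟨hxy.1.trans hyz.1, fun j hx hz => by
    -- Transitivity rests on order-convexity: a coordinate free at both ends is free in the middle.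
    have hy : y.1.1 ∈ I j := (hI j).out hx hz ⟨hxy.1, hyz.1⟩
    exact (hxy.2 j hx hy).trans (hyz.2 j hy hz)⟩
  le_antisymm x y hxy hyx := ext_of_agree (le_antisymm hxy.1 hyx.1) hxy.2

theorem lt_iff (hI : ∀ j, (I j).OrdConnected) (x y : ColorPoset n I w) :
    letI := partialOrder (n := n) (w := w) hI
    x < y ↔ x.1.1 < y.1.1 ∧ ∀ j, x.1.1 ∈ I j → y.1.1 ∈ I j → x.1.2 j = y.1.2 j := by
  let := partialOrder (n := n) (w := w) hI
  constructor
  · intro h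
    refine ⟨lt_of_le_of_ne h.le.1 fun he => h.ne (ext_of_agree he h.le.2), h.le.2⟩
  · rintro ⟨h1, h2⟩
    exact lt_of_le_of_ne ⟨h1.le, h2⟩ fun he => h1.ne (by rw [he])

/-- The element of rank `i` whose free coordinates are given by `g`. -/
noncomputable def mk' (I : J → Set ℕ) (hw : ∀ j, 0 < w j) (i : ℕ) (hi : i ≤ n + 1) (g : J → ℕ)
    (hg : ∀ j, g j < w j) : ColorPoset n I w := by
  classical
  exact ⟨(i, fun j => if i ∈ I j then g j else 0), hi, fun j => by
    constructor
    · dsimp only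
      split_ifs
      exacts [hg j, hw j]
    · intro h
      exact if_neg h⟩

theorem mk'_snd (hw : ∀ j, 0 < w j) (i : ℕ) (hi : i ≤ n + 1) (g : J → ℕ)
    (hg : ∀ j, g j < w j) (j : J) (h : i ∈ I j) : (mk' I hw i hi g hg).1.2 j = g j := by
  classical
  exact if_pos h

/-- The least element has rank `0` and the greatest has rank `n + 1`. -/
@[reducible] noncomputable def boundedOrder (hI : ∀ j, (I j).OrdConnected)
    (hIn : ∀ j, I j ⊆ Set.Icc 1 n) (hw : ∀ j, 0 < w j) :
    letI := partialOrder (n := n) (w := w) hI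
    BoundedOrder (ColorPoset n I w) :=
  letI := partialOrder (n := n) (w := w) hI
  { top := mk' I hw (n + 1) le_rfl (fun _ => 0) hw
    le_top := fun x => ⟨x.2.1, fun j _ h => absurd (hIn j h).2 (by simp [mk'])⟩
    bot := mk' I hw 0 (Nat.zero_le _) (fun _ => 0) hw
    bot_le := fun x => ⟨Nat.zero_le _, fun j h _ => absurd (hIn j h).1 (by simp [mk'])⟩ }

theorem exists_between (hI : ∀ j, (I j).OrdConnected) (hw : ∀ j, 0 < w j)
    (x y : ColorPoset n I w)
    (h : letI := partialOrder (n := n) (w := w) hI; x < y) (i : ℕ) (hx : x.1.1 < i)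
    (hy : i < y.1.1) :
    letI := partialOrder (n := n) (w := w) hI
    ∃ z, x < z ∧ z < y ∧ z.1.1 = i := by
  classical
  let := partialOrder (n := n) (w := w) hI
  -- The new element copies `x` where `x` is free and `y` elsewhere; where both are free they agree.
  refine ⟨mk' I hw i (hy.le.trans y.2.1) (fun j => if x.1.1 ∈ I j then x.1.2 j else y.1.2 j)
    (fun j => ?_), ?_, ?_, rfl⟩
  · split_ifs
    exacts [(x.2.2 j).1, (y.2.2 j).1]
  · rw [lt_iff hI]
    refine ⟨hx, fun j h1 (h2 : i ∈ I j) => ?_⟩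
    rw [mk'_snd _ _ _ _ _ _ h2, if_pos h1]
  · rw [lt_iff hI]
    refine ⟨hy, fun j (h1 : i ∈ I j) h2 => ?_⟩
    rw [mk'_snd _ _ _ _ _ _ h1]
    split_ifs with h3
    · exact ((lt_iff hI _ _).1 h).2 j h3 h2
    · rfl

/-- The poset is graded by the first coordinate. -/
@[reducible] noncomputable def gradeMinOrder (hI : ∀ j, (I j).OrdConnected)
    (hIn : ∀ j, I j ⊆ Set.Icc 1 n) (hw : ∀ j, 0 < w j) :
    letI := partialOrder (n := n) (w := w) hI
    GradeMinOrder ℕ (ColorPoset n I w) :=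
  letI := partialOrder (n := n) (w := w) hI
  letI := boundedOrder (n := n) (w := w) hI hIn hw
  { grade := fun x => x.1.1
    grade_strictMono := fun x y h => ((lt_iff hI x y).1 h).1
    covBy_grade := fun {x y} h => by
      have hlt := ((lt_iff hI x y).1 h.1).1
      rw [Nat.covBy_iff_add_one_eq]
      by_contra hne
      obtain ⟨z, h1, h2, -⟩ := exists_between hI hw x y h.1 (x.1.1 + 1) (by omega) (by omega)
      exact h.2 h1 h2
    isMin_grade := fun {x} h => by
      have : x = ⊥ := h.eq_bot
      rw [this]
      exact isMin_bot }

/-- The coordinate attached to the single rank of `z` is invisible to `x` and `y`, so its `r` values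
give `r` elements of the interval. -/
theorem isThick (hI : ∀ j, (I j).OrdConnected) (hw : ∀ j, 0 < w j) [Finite J] (r : ℕ)
    (hr : ∀ i ∈ Set.Icc 1 n, ∃ j, I j = {i} ∧ w j = r) :
    letI := partialOrder (n := n) (w := w) hI
    IsThick r (ColorPoset n I w) := by
  classical
  let := partialOrder (n := n) (w := w) hI
  rintro x y ⟨z, hxz, hzy⟩
  have hxz' := (lt_iff hI _ _).1 hxz
  have hzy' := (lt_iff hI _ _).1 hzy
  have hy := y.2.1
  obtain ⟨j₀, hj₀, hwj⟩ := hr z.1.1 ⟨by omega, by omega⟩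
  have hlt : ∀ a, a < r → ∀ j, (if j = j₀ then a else z.1.2 j) < w j := by
    intro a ha j
    split_ifs with h
    · rw [h, hwj]; exact ha
    · exact (z.2.2 j).1
  let f : ℕ → ColorPoset n I w := fun a =>
    if ha : a < r then mk' I hw z.1.1 z.2.1 (fun j => if j = j₀ then a else z.1.2 j) (hlt a ha)
    else z
  have hf : ∀ a (ha : a < r), f a =
      mk' I hw z.1.1 z.2.1 (fun j => if j = j₀ then a else z.1.2 j) (hlt a ha) :=
    fun a ha => dif_pos ha
  have hmem : z.1.1 ∈ I j₀ := by rw [hj₀]; rfl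
  have hinj : Set.InjOn f (Set.Iio r) := by
    intro a ha b hb hab
    rw [hf a ha, hf b hb] at hab
    have := congrArg (fun u => u.1.2 j₀) hab
    simpa only [mk'_snd _ _ _ _ _ _ hmem, if_true] using this
  have himg : f '' Set.Iio r ⊆ Set.Ioo x y := by
    rintro _ ⟨a, ha, rfl⟩
    rw [hf a ha]
    refine ⟨(lt_iff hI _ _).2 ⟨hxz'.1, fun j h1 (h2 : z.1.1 ∈ I j) => ?_⟩,
      (lt_iff hI _ _).2 ⟨hzy'.1, fun j (h1 : z.1.1 ∈ I j) h2 => ?_⟩⟩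
    · have hj : j ≠ j₀ := by
        rintro rfl
        rw [hj₀] at h1
        exact hxz'.1.ne h1
      rw [mk'_snd _ _ _ _ _ _ h2, if_neg hj]
      exact hxz'.2 j h1 h2
    · have hj : j ≠ j₀ := by
        rintro rfl
        rw [hj₀] at h2
        exact hzy'.1.ne' h2
      rw [mk'_snd _ _ _ _ _ _ h1, if_neg hj]
      exact hzy'.2 j h1 h2
  calc r = (Set.Iio r).ncard := by
        rw [← Finset.coe_Iio, Set.ncard_coe_finset, Nat.card_Iio]
    _ = (f '' Set.Iio r).ncard := hinj.ncard_image.symm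
    _ ≤ _ := Set.ncard_le_ncard himg (Set.toFinite _)

-- Comparable elements agree on common free coordinates, so a chain with rank set `S` amounts to one
-- common value for each coordinate free at some rank of `S`.
open Classical in
theorem flagNumber_eq [Fintype J] (hI : ∀ j, (I j).OrdConnected)
    (hIn : ∀ j, I j ⊆ Set.Icc 1 n) (hw : ∀ j, 0 < w j) (S : Finset ℕ) (hS : S ⊆ Finset.Icc 1 n) :
    letI := partialOrder (n := n) (w := w) hI
    letI := gradeMinOrder (n := n) (w := w) hI hIn hw
    flagNumber (ColorPoset n I w) S = ∏ j, if ∃ i ∈ S, i ∈ I j then w j else 1 := by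
  let := partialOrder (n := n) (w := w) hI
  let := gradeMinOrder (n := n) (w := w) hI hIn hw
  have hgr : ∀ x : ColorPoset n I w, grade ℕ x = x.1.1 := fun _ => rfl
  -- Coordinates that `S` never sees are pinned to `0`, so that distinct choices give distinct
  -- chains.
  let G : Finset (J → ℕ) :=
    Fintype.piFinset fun j => Finset.range (if ∃ i ∈ S, i ∈ I j then w j else 1)
  have hcard : G.card = ∏ j, if ∃ i ∈ S, i ∈ I j then w j else 1 := by
    simp [G, Fintype.card_piFinset]
  have hGw : ∀ g ∈ G, ∀ j, g j < w j := by
    intro g hg j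
    have := Finset.mem_range.1 (Fintype.mem_piFinset.1 hg j)
    split_ifs at this
    · exact this
    · exact this.trans_le (hw j)
  have hG0 : ∀ g ∈ G, ∀ j, (¬ ∃ i ∈ S, i ∈ I j) → g j = 0 := by
    intro g hg j hj
    have := Finset.mem_range.1 (Fintype.mem_piFinset.1 hg j)
    rw [if_neg hj] at this
    omega
  have hSn : ∀ i ∈ S, i ≤ n + 1 := fun i hi => by
    have := Finset.mem_Icc.1 (hS hi)
    omega
  let f : (J → ℕ) → Set (ColorPoset n I w) := fun g =>
    {x | x.1.1 ∈ S ∧ ∀ j, x.1.1 ∈ I j → x.1.2 j = g j}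
  have hex : ∀ g ∈ G, ∀ i ∈ S, ∃ x ∈ f g, x.1.1 = i := fun g hg i hi =>
    ⟨mk' I hw i (hSn i hi) g (hGw g hg), ⟨hi, fun j hj => mk'_snd _ _ _ _ _ _ hj⟩, rfl⟩
  have hinj : Set.InjOn f G := by
    intro g hg g' hg' h
    funext j
    by_cases hj : ∃ i ∈ S, i ∈ I j
    · obtain ⟨i, hi, hij⟩ := hj
      obtain ⟨x, hx, rfl⟩ := hex g hg i hi
      have hx' : x ∈ f g' := h ▸ hx
      rw [← hx.2 j hij, hx'.2 j hij]
    · rw [hG0 g hg j hj, hG0 g' hg' j hj]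
  have himg : {C : Set (ColorPoset n I w) | IsChain (· ≤ ·) C ∧ grade ℕ '' C = (S : Set ℕ)} =
      f '' G := by
    ext C
    constructor
    · rintro ⟨hC, hCS⟩
      have hmemS : ∀ x ∈ C, x.1.1 ∈ S := fun x hx => by
        have : grade ℕ x ∈ grade ℕ '' C := ⟨x, hx, rfl⟩
        rw [hCS] at this
        exact this
      have hlift : ∀ i ∈ S, ∃ x ∈ C, x.1.1 = i := fun i hi => by
        have : i ∈ grade ℕ '' C := by rw [hCS]; exact hi
        exact this
      have hagree : ∀ x ∈ C, ∀ y ∈ C, ∀ j, x.1.1 ∈ I j → y.1.1 ∈ I j → x.1.2 j = y.1.2 j := by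
        intro x hx y hy j h1 h2
        rcases hC.total hx hy with h | h
        · exact h.2 j h1 h2
        · exact (h.2 j h2 h1).symm
      let g : J → ℕ := fun j =>
        if h : ∃ x ∈ C, x.1.1 ∈ I j then h.choose.1.2 j else 0
      have hg : ∀ x ∈ C, ∀ j, x.1.1 ∈ I j → x.1.2 j = g j := by
        intro x hx j hj
        have h : ∃ x ∈ C, x.1.1 ∈ I j := ⟨x, hx, hj⟩
        simp only [g, dif_pos h]
        exact hagree x hx _ h.choose_spec.1 j hj h.choose_spec.2
      refine ⟨g, ?_, ?_⟩
      · refine Fintype.mem_piFinset.2 fun j => Finset.mem_range.2 ?_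
        by_cases h : ∃ x ∈ C, x.1.1 ∈ I j
        · rw [if_pos ⟨_, hmemS _ h.choose_spec.1, h.choose_spec.2⟩]
          simp only [g, dif_pos h]
          exact (h.choose.2.2 j).1
        · simp only [g, dif_neg h]
          split_ifs
          exacts [hw j, one_pos]
      · ext x
        constructor
        · rintro ⟨hxS, hx⟩
          obtain ⟨y, hy, hyx⟩ := hlift _ hxS
          have : x = y := ext_of_agree hyx.symm fun j h1 h2 => by rw [hx j h1, hg y hy j h2]
          rw [this]
          exact hy
        · intro hx
          exact ⟨hmemS x hx, hg x hx⟩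
    · rintro ⟨g, hg, rfl⟩
      constructor
      · intro x hx y hy _
        have key : ∀ j, x.1.1 ∈ I j → y.1.1 ∈ I j → x.1.2 j = y.1.2 j := fun j h1 h2 => by
          rw [hx.2 j h1, hy.2 j h2]
        rcases le_total x.1.1 y.1.1 with h | h
        · exact Or.inl ⟨h, key⟩
        · exact Or.inr ⟨h, fun j h1 h2 => (key j h2 h1).symm⟩
      · ext i
        constructor
        · rintro ⟨x, hx, rfl⟩
          exact hx.1
        · intro hi
          exact hex g hg i hi
  rw [flagNumber, himg, hinj.ncard_image, Set.ncard_coe_finset, hcard]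

end ColorPoset

/-! ### Early atoms and the count of early chains. -/

/-- Among a finite set with at least `r` elements, exactly `r` elements have fewer than `r`
predecessors in the order pulled back along an injective map. -/
theorem card_filter_card_lt {α : Type} [DecidableEq α] (e : α → ℕ) (he : Function.Injective e)
    (A : Finset α) (r : ℕ) (hr : r ≤ A.card) :
    (A.filter fun z => (A.filter fun w => e w < e z).card < r).card = r := by
  let φ : α → ℕ := fun z => (A.filter fun w => e w < e z).card
  have hlt : ∀ z ∈ A, ∀ z', e z < e z' → φ z < φ z' := by
    intro z hz z' h
    apply Finset.card_lt_card
    refine ⟨fun w hw => ?_, fun hsub => ?_⟩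
    · rw [Finset.mem_filter] at hw ⊢
      exact ⟨hw.1, hw.2.trans h⟩
    · exact lt_irrefl _ (Finset.mem_filter.1 (hsub (Finset.mem_filter.2 ⟨hz, h⟩))).2
  have hinj : Set.InjOn φ A := by
    intro z hz z' hz' h
    rcases lt_trichotomy (e z) (e z') with h1 | h1 | h1
    · exact absurd h (hlt z hz z' h1).ne
    · exact he h1
    · exact absurd h (hlt z' hz' z h1).ne'
  -- The numbers of predecessors are distinct and below `A.card`, hence take every such value once.
  have himg : A.image φ = Finset.range A.card := by
    apply Finset.eq_of_subset_of_card_le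
    · intro k hk
      obtain ⟨z, hz, rfl⟩ := Finset.mem_image.1 hk
      refine Finset.mem_range.2 (Finset.card_lt_card ?_)
      exact Finset.filter_ssubset.2 ⟨z, hz, lt_irrefl _⟩
    · rw [Finset.card_range, Finset.card_image_of_injOn hinj]
  have h2 : (A.filter fun z => φ z < r).image φ = Finset.range r := by
    ext k
    simp only [Finset.mem_image, Finset.mem_filter, Finset.mem_range]
    constructor
    · rintro ⟨z, ⟨-, hz⟩, rfl⟩
      exact hz
    · intro hk
      have : k ∈ A.image φ := by
        rw [himg, Finset.mem_range]
        omega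
      obtain ⟨z, hz, rfl⟩ := Finset.mem_image.1 this
      exact ⟨z, ⟨hz, hk⟩, rfl⟩
  have h3 := congrArg Finset.card h2
  rwa [Finset.card_range, Finset.card_image_of_injOn
    (hinj.mono (Finset.coe_subset.2 (Finset.filter_subset _ _)))] at h3

section Early

variable {P : Type} [PartialOrder P] [GradeMinOrder ℕ P] [Fintype P]

open Classical in
/-- The elements covering `x` inside the interval `[x, y]`. -/
noncomputable def atoms (x y : P) : Finset P :=
  Finset.univ.filter fun z => x < z ∧ z ≤ y ∧ grade ℕ z = grade ℕ x + 1

open Classical in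
/-- The first `r` atoms of `[x, y]` in the order given by `e`. -/
noncomputable def earlyAtoms (e : P → ℕ) (r : ℕ) (x y : P) : Finset P :=
  (atoms x y).filter fun z => ((atoms x y).filter fun w => e w < e z).card < r

theorem mem_atoms {x y z : P} : z ∈ atoms x y ↔ x < z ∧ z ≤ y ∧ grade ℕ z = grade ℕ x + 1 := by
  classical
  simp [atoms]

theorem earlyAtoms_subset (e : P → ℕ) (r : ℕ) (x y : P) : earlyAtoms e r x y ⊆ atoms x y := by
  classical
  exact Finset.filter_subset _ _

/-- Being an early atom is inherited by smaller intervals. -/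
theorem mem_earlyAtoms_of_le {e : P → ℕ} {r : ℕ} {x y y' z : P} (h : z ∈ earlyAtoms e r x y)
    (hz : z ≤ y') (hy : y' ≤ y) : z ∈ earlyAtoms e r x y' := by
  classical
  have hz' := mem_atoms.1 (earlyAtoms_subset _ _ _ _ h)
  refine Finset.mem_filter.2 ⟨mem_atoms.2 ⟨hz'.1, hz, hz'.2.2⟩, ?_⟩
  refine lt_of_le_of_lt (Finset.card_le_card ?_) (Finset.mem_filter.1 h).2
  apply Finset.filter_subset_filter
  intro w hw
  have := mem_atoms.1 hw
  exact mem_atoms.2 ⟨this.1, this.2.1.trans hy, this.2.2⟩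

theorem grade_of_covBy {P : Type} [PartialOrder P] [GradeMinOrder ℕ P] {x y : P} (h : x ⋖ y) : grade ℕ y = grade ℕ x + 1 :=
  (Nat.covBy_iff_add_one_eq.1 (h.grade ℕ)).symm

/-- For `u ≤ y` two ranks above `x`, the open interval from `x` to `u` consists of atoms of `[x,
y]`, and thickness bounds its size below. -/
theorem card_earlyAtoms {e : P → ℕ} (he : Function.Injective e) {r : ℕ} (hP : IsThick r P)
    {x y : P} (hxy : x < y) (hg : grade ℕ x + 1 < grade ℕ y) :
    (earlyAtoms e r x y).card = r := by
  classical
  apply card_filter_card_lt e he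
  obtain ⟨z, hxz, hzy⟩ := exists_covBy_le_of_lt hxy
  have hz := grade_of_covBy hxz
  obtain ⟨u, hzu, huy⟩ := exists_covBy_le_of_lt
    (lt_of_le_of_ne hzy fun h => by rw [h] at hz; omega)
  have hu := grade_of_covBy hzu
  refine (hP x u ⟨z, hxz.1, hzu.1⟩).trans ?_
  rw [← Set.ncard_coe_finset]
  refine Set.ncard_le_ncard (fun w hw => ?_) (Set.toFinite _)
  have h1 := grade_strictMono (𝕆 := ℕ) hw.1
  have h2 := grade_strictMono (𝕆 := ℕ) hw.2
  exact Finset.mem_coe.2 (mem_atoms.2 ⟨hw.1, hw.2.le.trans huy, by omega⟩)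

/-- Chains with rank set `T`, written as functions of the rank. -/
structure IsRankChain [OrderBot P] (T : Finset ℕ) (c : ℕ → P) : Prop where
  grade_eq : ∀ i ∈ T, grade ℕ (c i) = i
  lt : ∀ i ∈ T, ∀ j ∈ T, i < j → c i < c j
  eq_bot : ∀ i ∉ T, c i = ⊥

theorem finite_isRankChain [OrderBot P] (T : Finset ℕ) :
    {c : ℕ → P | IsRankChain T c}.Finite := by
  classical
  apply Set.Finite.of_injOn (f := fun (c : ℕ → P) (i : T) => c i) (t := Set.univ)
    (Set.mapsTo_univ _ _) _ Set.finite_univ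
  intro c hc d hd h
  funext i
  by_cases hi : i ∈ T
  · exact congrFun h ⟨i, hi⟩
  · rw [hc.eq_bot i hi, hd.eq_bot i hi]

/-- A chain containing the ranks `S ∪ {n + 1} ∪ [0, t]` whose elements of rank `k ∈ [1, t] \ S`
are early atoms of the interval between rank `k - 1` and the next rank in `S ∪ {n + 1}`. -/
structure IsEarlyChain [OrderBot P] (e : P → ℕ) (r n : ℕ) (S : Finset ℕ) (t : ℕ) (c : ℕ → P) :
    Prop where
  isRankChain : IsRankChain (insert (n + 1) S ∪ Finset.range (t + 1)) c
  mem : ∀ k < t, ∀ m ∈ insert (n + 1) S, k + 1 < m → (∀ i ∈ S, k < i → m ≤ i) →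
    c (k + 1) ∈ earlyAtoms e r (c k) (c m)

theorem finite_isEarlyChain [OrderBot P] (e : P → ℕ) (r n : ℕ) (S : Finset ℕ) (t : ℕ) :
    {c : ℕ → P | IsEarlyChain e r n S t c}.Finite :=
  (finite_isRankChain (P := P) _).subset fun _ hc => hc.isRankChain

/-- At stage `0` no earliness condition applies, and the added ranks `0` and `n + 1` force the
elements `⊥` and `⊤`. -/
theorem ncard_isEarlyChain_zero [BoundedOrder P] (e : P → ℕ) (r n : ℕ) (S : Finset ℕ)
    (hS : S ⊆ Finset.Icc 1 n) (htop : grade ℕ (⊤ : P) = n + 1) :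
    {c : ℕ → P | IsEarlyChain e r n S 0 c}.ncard = flagNumber P S := by
  classical
  have hSn : ∀ i ∈ S, 1 ≤ i ∧ i ≤ n := fun i hi => Finset.mem_Icc.1 (hS hi)
  have hbot : grade ℕ (⊥ : P) = 0 := grade_bot
  have hT : ∀ i, i ∈ insert (n + 1) S ∪ Finset.range (0 + 1) ↔ i = 0 ∨ i ∈ S ∨ i = n + 1 := by
    intro i
    simp only [Finset.mem_union, Finset.mem_insert, Finset.mem_range]
    constructor
    · rintro ((h | h) | h)
      · exact Or.inr (Or.inr h)
      · exact Or.inr (Or.inl h)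
      · exact Or.inl (by omega)
    · rintro (h | h | h)
      · exact Or.inr (by omega)
      · exact Or.inl (Or.inr h)
      · exact Or.inl (Or.inl h)
  have htop' : ∀ x : P, grade ℕ x = n + 1 → x = ⊤ := fun x hx => by
    by_contra h
    have := grade_strictMono (𝕆 := ℕ) (lt_top_iff_ne_top.2 h)
    omega
  have hbot' : ∀ x : P, grade ℕ x = 0 → x = ⊥ := fun x hx => by
    by_contra h
    have := grade_strictMono (𝕆 := ℕ) (bot_lt_iff_ne_bot.2 h)
    omega
  let f : (ℕ → P) → Set P := fun c => c '' S
  have hgr : ∀ c : ℕ → P, IsEarlyChain e r n S 0 c → ∀ i ∈ S, grade ℕ (c i) = i :=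
    fun c hc i hi => hc.1.grade_eq i ((hT i).2 (Or.inr (Or.inl hi)))
  have hinj : Set.InjOn f {c : ℕ → P | IsEarlyChain e r n S 0 c} := by
    intro c hc d hd h
    funext i
    by_cases hi : i ∈ insert (n + 1) S ∪ Finset.range (0 + 1)
    · rcases (hT i).1 hi with h0 | h0 | h0
      · rw [hbot' (c i) (by rw [hc.1.grade_eq i hi, h0]), hbot' (d i) (by rw [hd.1.grade_eq i hi, h0])]
      · have : c i ∈ f d := h ▸ ⟨i, h0, rfl⟩
        obtain ⟨j, hj, hji⟩ := this
        have h1 := hgr c hc i h0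
        rw [← hji, hgr d hd j hj] at h1
        rw [← hji, h1]
      · rw [htop' (c i) (by rw [hc.1.grade_eq i hi, h0]), htop' (d i) (by rw [hd.1.grade_eq i hi, h0])]
    · rw [hc.1.eq_bot i hi, hd.1.eq_bot i hi]
  have himg : {C : Set P | IsChain (· ≤ ·) C ∧ grade ℕ '' C = (S : Set ℕ)} =
      f '' {c : ℕ → P | IsEarlyChain e r n S 0 c} := by
    ext C
    constructor
    · rintro ⟨hC, hCS⟩
      have hlift : ∀ i ∈ S, ∃ x ∈ C, grade ℕ x = i := fun i hi => by
        have : i ∈ grade ℕ '' C := by rw [hCS]; exact hi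
        exact this
      choose! g hgC hgg using hlift
      have huniq : ∀ x ∈ C, ∀ y ∈ C, grade ℕ x ≤ grade ℕ y → x ≤ y := by
        intro x hx y hy hxy
        rcases hC.total hx hy with h | h
        · exact h
        · rcases h.eq_or_lt with h | h
          · exact h.ge
          · have := grade_strictMono (𝕆 := ℕ) h
            omega
      let c : ℕ → P := fun i => if i ∈ S then g i else if i = n + 1 then ⊤ else ⊥
      have hcS : ∀ i ∈ S, c i = g i := fun i hi => if_pos hi
      have hc1 : c (n + 1) = ⊤ := by
        have : n + 1 ∉ S := fun h => by have := hSn _ h; omega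
        simp [c, this]
      have hc0 : ∀ i, i ∉ S → i ≠ n + 1 → c i = ⊥ := fun i h1 h2 => by simp [c, h1, h2]
      have h00 : c 0 = ⊥ := hc0 0 (fun h => by have := hSn _ h; omega) (by omega)
      have hcg : ∀ i ∈ insert (n + 1) S ∪ Finset.range (0 + 1), grade ℕ (c i) = i := by
        intro i hi
        rcases (hT i).1 hi with rfl | hi | rfl
        · rw [h00, hbot]
        · rw [hcS i hi, hgg i hi]
        · rw [hc1, htop]
      refine ⟨c, ⟨⟨hcg, ?_, ?_⟩, ?_⟩, ?_⟩
      · intro i hi j hj hij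
        have h1 := hcg i hi
        have h2 := hcg j hj
        have hne : c i ≠ c j := fun h => by rw [h] at h1; omega
        refine lt_of_le_of_ne ?_ hne
        rcases (hT i).1 hi with rfl | hi | rfl
        · rw [h00]; exact bot_le
        · rcases (hT j).1 hj with rfl | hj | rfl
          · omega
          · rw [hcS i hi, hcS j hj]
            refine huniq _ (hgC i hi) _ (hgC j hj) ?_
            rw [hgg i hi, hgg j hj]
            exact hij.le
          · rw [hc1]; exact le_top
        · rcases (hT j).1 hj with rfl | hj | rfl
          · omega
          · have := hSn j hj
            omega
          · omega
      · intro i hi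
        rw [hT] at hi
        push Not at hi
        exact hc0 i hi.2.1 hi.2.2
      · intro k hk
        omega
      · ext x
        constructor
        · rintro ⟨i, hi, rfl⟩
          rw [hcS i hi]
          exact hgC i hi
        · intro hx
          have hxS : grade ℕ x ∈ S := by
            have : grade ℕ x ∈ grade ℕ '' C := ⟨x, hx, rfl⟩
            rw [hCS] at this
            exact this
          refine ⟨grade ℕ x, hxS, ?_⟩
          rw [hcS _ hxS]
          exact le_antisymm (huniq _ (hgC _ hxS) _ hx (hgg _ hxS).le)
            (huniq _ hx _ (hgC _ hxS) (hgg _ hxS).ge)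
    · rintro ⟨c, hc, rfl⟩
      constructor
      · rintro _ ⟨i, hi, rfl⟩ _ ⟨j, hj, rfl⟩ hne
        have hi' := (hT i).2 (Or.inr (Or.inl hi))
        have hj' := (hT j).2 (Or.inr (Or.inl hj))
        rcases lt_trichotomy i j with h | h | h
        · exact Or.inl (hc.1.lt i hi' j hj' h).le
        · exact absurd (congrArg c h) hne
        · exact Or.inr (hc.1.lt j hj' i hi' h).le
      · ext i
        constructor
        · rintro ⟨_, ⟨j, hj, rfl⟩, rfl⟩
          rw [hgr c hc j hj]
          exact hj
        · intro hi
          exact ⟨c i, ⟨i, hi, rfl⟩, hgr c hc i hi⟩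
  rw [flagNumber, himg, hinj.ncard_image]

theorem isEarlyChain_succ_of_mem [OrderBot P] (e : P → ℕ) (r n : ℕ) (S : Finset ℕ) (t : ℕ)
    (ht : t + 1 ∈ S) (c : ℕ → P) :
    IsEarlyChain e r n S (t + 1) c ↔ IsEarlyChain e r n S t c := by
  have hT : insert (n + 1) S ∪ Finset.range (t + 1 + 1) =
      insert (n + 1) S ∪ Finset.range (t + 1) := by
    rw [Finset.range_add_one, Finset.union_insert, Finset.insert_eq_self]
    simp [ht]
  constructor
  · rintro ⟨h1, h2⟩
    exact ⟨hT ▸ h1, fun k hk => h2 k (by omega)⟩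
  · rintro ⟨h1, h2⟩
    refine ⟨hT.symm ▸ h1, fun k hk m hm hkm hS => ?_⟩
    rcases (Nat.lt_succ_iff_lt_or_eq.1 hk) with h | rfl
    · exact h2 k h m hm hkm hS
    -- For `k = t` the next prescribed rank is `t + 1` itself, so the condition is vacuous.
    · have := hS _ ht (by omega)
      omega

/-- Each early chain has exactly `r` extensions by an element of a new rank. -/
theorem ncard_isEarlyChain_succ [OrderBot P] {e : P → ℕ} (he : Function.Injective e) {r n : ℕ}
    (hP : IsThick r P) (S : Finset ℕ) (hS : S ⊆ Finset.Icc 1 n) (t : ℕ) (htn : t < n)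
    (ht : t + 1 ∉ S) :
    {c : ℕ → P | IsEarlyChain e r n S (t + 1) c}.ncard =
      r * {c : ℕ → P | IsEarlyChain e r n S t c}.ncard := by
  classical
  have hT : insert (n + 1) S ∪ Finset.range (t + 1 + 1) =
      insert (t + 1) (insert (n + 1) S ∪ Finset.range (t + 1)) := by
    rw [Finset.range_add_one, Finset.union_insert]
  set T := insert (n + 1) S ∪ Finset.range (t + 1) with hTdef
  have htT : t + 1 ∉ T := by
    simp only [hTdef, Finset.mem_union, Finset.mem_insert, Finset.mem_range]
    rintro ((h | h) | h)
    · omega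
    · exact ht h
    · omega
  have htT0 : t ∈ T := by simp [hTdef]
  -- `m` is the next prescribed rank after `t`; it exceeds `t + 1` because `t + 1 ∉ S`.
  obtain ⟨m, hmS, htm, hmin⟩ : ∃ m ∈ insert (n + 1) S, t + 1 < m ∧
      ∀ i ∈ insert (n + 1) S, t < i → m ≤ i := by
    have hne : ((insert (n + 1) S).filter fun i => t < i).Nonempty :=
      ⟨n + 1, Finset.mem_filter.2 ⟨Finset.mem_insert_self _ _, by omega⟩⟩
    obtain ⟨h1, h2⟩ := Finset.mem_filter.1 (Finset.min'_mem _ hne)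
    refine ⟨_, h1, lt_of_le_of_ne h2 fun h => ?_, fun i hi hti =>
      Finset.min'_le _ _ (Finset.mem_filter.2 ⟨hi, hti⟩)⟩
    rw [← Nat.succ_eq_add_one] at h
    rw [← h] at h1
    rcases Finset.mem_insert.1 h1 with h3 | h3
    · simp only [Nat.succ_eq_add_one] at h3
      omega
    · exact ht h3
  have hmT : m ∈ T := Finset.mem_union_left _ hmS
  have hTsplit : ∀ i ∈ T, i ≤ t ∨ m ≤ i := by
    intro i hi
    rcases Finset.mem_union.1 hi with h | h
    · rcases le_or_gt i t with h' | h'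
      · exact Or.inl h'
      · exact Or.inr (hmin i h h')
    · exact Or.inl (by have := Finset.mem_range.1 h; omega)
  have hmuniq : ∀ m' ∈ insert (n + 1) S, t + 1 < m' → (∀ i ∈ S, t < i → m' ≤ i) → m' = m := by
    intro m' hm' htm' hmin'
    apply le_antisymm _ (hmin m' hm' (by omega))
    rcases Finset.mem_insert.1 hmS with h | h
    · rw [h]
      rcases Finset.mem_insert.1 hm' with h' | h'
      · exact h'.le
      · have := Finset.mem_Icc.1 (hS h')
        omega
    · exact hmin' m h (by omega)
  have hfin := finite_isEarlyChain e r n S t (P := P)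
  have hfin' := finite_isEarlyChain e r n S (t + 1) (P := P)
  let A := hfin.toFinset
  let B := hfin'.toFinset
  have hA : ∀ c, c ∈ A ↔ IsEarlyChain e r n S t c := fun c => by simp [A]
  have hB : ∀ c, c ∈ B ↔ IsEarlyChain e r n S (t + 1) c := fun c => by simp [B]
  -- Forgetting the element of rank `t + 1` resets it to the default `⊥`; the fibres of this map are
  -- the choices of an early atom.
  let φ : (ℕ → P) → (ℕ → P) := fun c => Function.update c (t + 1) ⊥
  have hne : ∀ i ∈ T, i ≠ t + 1 := fun i hi h => htT (h ▸ hi)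
  have hkm : ∀ k < t, ∀ m' ∈ insert (n + 1) S, k ≠ t + 1 ∧ k + 1 ≠ t + 1 ∧ m' ≠ t + 1 :=
    fun k hk m' hm' => ⟨by omega, by omega, hne m' (Finset.mem_union_left _ hm')⟩
  have hφ : ∀ c ∈ B, φ c ∈ A := by
    intro c hc
    rw [hB] at hc
    rw [hA]
    have hrc := hT ▸ hc.1
    refine ⟨⟨fun i hi => ?_, fun i hi j hj hij => ?_, fun i hi => ?_⟩, ?_⟩
    · simp only [φ, Function.update_of_ne (hne i hi)]
      exact hrc.grade_eq i (Finset.mem_insert_of_mem hi)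
    · simp only [φ, Function.update_of_ne (hne i hi), Function.update_of_ne (hne j hj)]
      exact hrc.lt i (Finset.mem_insert_of_mem hi) j (Finset.mem_insert_of_mem hj) hij
    · by_cases h : i = t + 1
      · simp [φ, h]
      · simp only [φ, Function.update_of_ne h]
        exact hrc.eq_bot i fun h' => (Finset.mem_insert.1 h').elim h hi
    · intro k hk m' hm' hkm' hmin'
      obtain ⟨h1, h2, h3⟩ := hkm k hk m' hm'
      simp only [φ, Function.update_of_ne h1, Function.update_of_ne h2, Function.update_of_ne h3]
      exact hc.2 k (by omega) m' hm' hkm' hmin'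
  have hfib : ∀ d ∈ A, (B.filter fun c => φ c = d) =
      (earlyAtoms e r (d t) (d m)).image fun z => Function.update d (t + 1) z := by
    intro d hd
    rw [hA] at hd
    ext c
    simp only [Finset.mem_filter, Finset.mem_image, hB]
    constructor
    · rintro ⟨hc, rfl⟩
      refine ⟨c (t + 1), ?_, by simp [φ]⟩
      simp only [φ, Function.update_of_ne (hne t htT0), Function.update_of_ne (hne m hmT)]
      exact hc.2 t (by omega) m hmS htm fun i hi => hmin i (Finset.mem_insert_of_mem hi)
    · rintro ⟨z, hz, rfl⟩
      have hz' := mem_atoms.1 (earlyAtoms_subset _ _ _ _ hz)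
      have hle : ∀ i ∈ T, i < t + 1 → d i < z := fun i hi hit => by
        rcases (Nat.lt_succ_iff_lt_or_eq.1 hit) with h | rfl
        · exact (hd.1.lt i hi t htT0 h).trans hz'.1
        · exact hz'.1
      have hmz : z < d m := by
        refine lt_of_le_of_ne hz'.2.1 fun h => ?_
        have h1 := hz'.2.2
        rw [h, hd.1.grade_eq m hmT, hd.1.grade_eq t htT0] at h1
        omega
      have hge : ∀ i ∈ T, t + 1 < i → z < d i := fun i hi hit => by
        have : m ≤ i := (hTsplit i hi).resolve_left (by omega)
        rcases this.eq_or_lt with h | h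
        · exact h ▸ hmz
        · exact hmz.trans (hd.1.lt m hmT i hi h)
      refine ⟨⟨hT.symm ▸ ⟨fun i hi => ?_, fun i hi j hj hij => ?_, fun i hi => ?_⟩, ?_⟩, ?_⟩
      · rcases Finset.mem_insert.1 hi with rfl | hi
        · rw [Function.update_self, hz'.2.2, hd.1.grade_eq t htT0]
        · rw [Function.update_of_ne (hne i hi), hd.1.grade_eq i hi]
      · rcases Finset.mem_insert.1 hi with rfl | hi
        · rcases Finset.mem_insert.1 hj with rfl | hj
          · omega
          · rw [Function.update_self, Function.update_of_ne (hne j hj)]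
            exact hge j hj hij
        · rcases Finset.mem_insert.1 hj with rfl | hj
          · rw [Function.update_self, Function.update_of_ne (hne i hi)]
            exact hle i hi hij
          · rw [Function.update_of_ne (hne i hi), Function.update_of_ne (hne j hj)]
            exact hd.1.lt i hi j hj hij
      · rw [Finset.mem_insert, not_or] at hi
        rw [Function.update_of_ne hi.1, hd.1.eq_bot i hi.2]
      · intro k hk m' hm' hkm' hmin'
        rcases (Nat.lt_succ_iff_lt_or_eq.1 hk) with h | rfl
        · obtain ⟨h1, h2, h3⟩ := hkm k h m' hm'
          rw [Function.update_of_ne h1, Function.update_of_ne h2, Function.update_of_ne h3]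
          exact hd.2 k h m' hm' hkm' hmin'
        · rw [hmuniq m' hm' hkm' hmin', Function.update_self, Function.update_of_ne (hne _ htT0),
            Function.update_of_ne (hne _ hmT)]
          exact hz
      · simp only [φ, Function.update_idem]
        rw [← hd.1.eq_bot _ htT, Function.update_eq_self]
  have hcard : ∀ d ∈ A, (B.filter fun c => φ c = d).card = r := by
    intro d hd
    rw [hfib d hd, Finset.card_image_of_injective _ (Function.update_injective _ _)]
    rw [hA] at hd
    refine card_earlyAtoms he hP (hd.1.lt t htT0 m hmT (by omega)) ?_
    rw [hd.1.grade_eq t htT0, hd.1.grade_eq m hmT]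
    exact htm
  rw [Set.ncard_eq_toFinset_card _ hfin', Set.ncard_eq_toFinset_card _ hfin]
  change B.card = r * A.card
  rw [Finset.card_eq_sum_card_fiberwise hφ, Finset.sum_congr rfl hcard, Finset.sum_const,
    smul_eq_mul, mul_comm]

/-- Each rank up to `t` outside `S` contributes a factor `r`, each rank in `S` a factor `1`. -/
theorem ncard_isEarlyChain [BoundedOrder P] {e : P → ℕ} (he : Function.Injective e) {r n : ℕ}
    (hP : IsThick r P) (htop : grade ℕ (⊤ : P) = n + 1) (S : Finset ℕ) (hS : S ⊆ Finset.Icc 1 n)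
    (t : ℕ) (htn : t ≤ n) :
    {c : ℕ → P | IsEarlyChain e r n S t c}.ncard =
      r ^ (Finset.Icc 1 t \ S).card * flagNumber P S := by
  induction t with
  | zero => simp [ncard_isEarlyChain_zero e r n S hS htop]
  | succ t ih =>
    have hI : Finset.Icc 1 (t + 1) = insert (t + 1) (Finset.Icc 1 t) := by
      ext i
      simp only [Finset.mem_insert, Finset.mem_Icc]
      omega
    by_cases ht : t + 1 ∈ S
    · simp only [isEarlyChain_succ_of_mem e r n S t ht]
      rw [ih (by omega), hI, Finset.insert_sdiff_of_mem _ ht]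
    · rw [ncard_isEarlyChain_succ he hP S hS t (by omega) ht, ih (by omega), hI,
        Finset.insert_sdiff_of_notMem _ ht, Finset.card_insert_of_notMem (by simp)]
      ring

/-! ### Late intervals of a maximal chain. -/

/-- The half-open rank intervals `[k + 1, m)` on which a maximal chain is not early. -/
def IsLate [OrderBot P] (e : P → ℕ) (r n : ℕ) (c : ℕ → P) (k m : ℕ) : Prop :=
  k + 1 < m ∧ m ≤ n + 1 ∧ c (k + 1) ∉ earlyAtoms e r (c k) (c m)

/-- A maximal chain is early with respect to `S` iff `S` meets all intervals on which the chain is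
late. -/
theorem isEarlyChain_iff [OrderBot P] (e : P → ℕ) (r n : ℕ) (S : Finset ℕ)
    (hS : S ⊆ Finset.Icc 1 n) (c : ℕ → P) :
    IsEarlyChain e r n S n c ↔ IsRankChain (Finset.range (n + 2)) c ∧
      ∀ k m, IsLate e r n c k m → ∃ i ∈ S, k < i ∧ i < m := by
  have hT : insert (n + 1) S ∪ Finset.range (n + 1) = Finset.range (n + 2) := by
    ext i
    simp only [Finset.mem_union, Finset.mem_insert, Finset.mem_range]
    constructor
    · rintro ((h | h) | h)
      · omega
      · have := Finset.mem_Icc.1 (hS h)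
        omega
      · omega
    · intro h
      by_cases h' : i = n + 1
      · exact Or.inl (Or.inl h')
      · exact Or.inr (by omega)
  constructor
  · rintro ⟨h1, h2⟩
    rw [hT] at h1
    refine ⟨h1, fun k m ⟨hkm, hmn, hlate⟩ => ?_⟩
    by_contra! hcon
    apply hlate
    have hne : ((insert (n + 1) S).filter fun i => k < i).Nonempty :=
      ⟨n + 1, Finset.mem_filter.2 ⟨Finset.mem_insert_self _ _, by omega⟩⟩
    obtain ⟨h3, h4⟩ := Finset.mem_filter.1 (Finset.min'_mem _ hne)
    have hmin : ∀ i ∈ S, k < i → Finset.min' _ hne ≤ i := fun i hi hki =>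
      Finset.min'_le _ _ (Finset.mem_filter.2 ⟨Finset.mem_insert_of_mem hi, hki⟩)
    -- `m'` is the next prescribed rank after `k`. As `S` misses the interval, `m ≤ m'`, and
    -- earliness up to `m'` passes down to `m`.
    generalize Finset.min' _ hne = m' at h3 h4 hmin
    have hm' : m ≤ m' ∧ m' ≤ n + 1 := by
      rcases Finset.mem_insert.1 h3 with h | h
      · omega
      · have := Finset.mem_Icc.1 (hS h)
        exact ⟨hcon m' h h4, by omega⟩
    have key := h2 k (by omega) m' h3 (by omega) hmin
    have hr : ∀ i, i ≤ n + 1 → i ∈ Finset.range (n + 2) := fun i hi => by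
      rw [Finset.mem_range]; omega
    refine mem_earlyAtoms_of_le key (h1.lt _ (hr _ (by omega)) _ (hr _ hmn) hkm).le ?_
    rcases hm'.1.eq_or_lt with h | h
    · rw [h]
    · exact (h1.lt _ (hr _ hmn) _ (hr _ hm'.2) h).le
  · rintro ⟨h1, h2⟩
    refine ⟨hT.symm ▸ h1, fun k hk m hm hkm hmin => ?_⟩
    by_contra hlate
    have hmn : m ≤ n + 1 := by
      rcases Finset.mem_insert.1 hm with h | h
      · omega
      · have := Finset.mem_Icc.1 (hS h)
        omega
    obtain ⟨i, hi, hki, him⟩ := h2 k m ⟨hkm, hmn, hlate⟩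
    have := hmin i hi hki
    omega

end Early


/-! ### Blocker vectors lie in the cone. -/

open Classical in
/-- The vector with value `r ^ |S|` at the sets `S` meeting all open intervals in `F`, with the
other values damped by a factor `ε` for each interval missed. -/
noncomputable def blockerVector (n r : ℕ) (F : Finset (ℕ × ℕ)) (ε : ℚ) : FlagSpace n :=
  fun S => (r : ℚ) ^ S.1.card * ∏ p ∈ F, if ∃ i ∈ S.1, p.1 < i ∧ i < p.2 then 1 else ε

theorem isClosed_thickCone (r n : ℕ) : IsClosed (thickCone r n : Set (FlagSpace n)) := by
  rw [thickCone, ConvexCone.coe_sInf]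
  exact isClosed_biInter fun C hC => hC.1

theorem thickFlagVectors_subset (r n : ℕ) :
    thickFlagVectors r n ⊆ (thickCone r n : Set (FlagSpace n)) := fun _ hv =>
  ConvexCone.mem_sInf.2 fun _ hC => hC.2 hv

theorem blockerVector_mem_of_pos (n r : ℕ) (hr : 0 < r) (F : Finset (ℕ × ℕ))
    (hF : ∀ p ∈ F, p.2 ≤ n + 1) (N : ℕ) :
    blockerVector n r F (1 / ((N : ℚ) + 1)) ∈ thickCone r n := by
  classical
  let I : F ⊕ Finset.Icc 1 n → Set ℕ := Sum.elim (fun p => Set.Ioo p.1.1 p.1.2) fun i => {i.1}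
  let w : F ⊕ Finset.Icc 1 n → ℕ := Sum.elim (fun _ => N + 1) fun _ => r
  have hI : ∀ j, (I j).OrdConnected := by
    rintro (p | i)
    · exact Set.ordConnected_Ioo
    · exact Set.ordConnected_singleton
  have hIn : ∀ j, I j ⊆ Set.Icc 1 n := by
    rintro (p | i) a ha
    · have h1 := hF p.1 p.2
      have ha' : p.1.1 < a ∧ a < p.1.2 := ha
      exact ⟨by omega, by omega⟩
    · have ha' : a = i.1 := ha
      rw [ha']
      exact Finset.mem_Icc.1 i.2
  have hw : ∀ j, 0 < w j := by
    rintro (p | i)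
    · exact Nat.succ_pos _
    · exact hr
  let := ColorPoset.partialOrder (n := n) (w := w) hI
  let := ColorPoset.boundedOrder (n := n) (w := w) hI hIn hw
  let := ColorPoset.gradeMinOrder (n := n) (w := w) hI hIn hw
  have hmem : flagVector n (ColorPoset n I w) ∈ thickCone r n :=
    thickFlagVectors_subset r n ⟨ColorPoset n I w, inferInstance, inferInstance, inferInstance,
      inferInstance, rfl, ColorPoset.isThick hI hw r fun i hi =>
        ⟨Sum.inr ⟨i, Finset.mem_Icc.2 hi⟩, rfl, rfl⟩, rfl⟩
  -- Scaling by `1 / (N + 1)` per interval turns the factor `N + 1` of a met interval into `1` and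
  -- the factor `1` of a missed one into `ε`.
  have heq : blockerVector n r F (1 / ((N : ℚ) + 1)) =
      (1 / ((N : ℚ) + 1)) ^ F.card • flagVector n (ColorPoset n I w) := by
    funext S
    have hS : S.1 ⊆ Finset.Icc 1 n := Finset.mem_powerset.1 S.2
    have hr' : (∏ i : Finset.Icc 1 n, if ∃ a ∈ S.1, a ∈ I (Sum.inr i) then w (Sum.inr i) else 1) =
        r ^ S.1.card := by
      have : ∀ i : Finset.Icc 1 n, (if ∃ a ∈ S.1, a ∈ I (Sum.inr i) then w (Sum.inr i) else 1) =
          if i.1 ∈ S.1 then r else 1 := fun i => by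
        simp [I, w]
      rw [Finset.prod_congr rfl fun i _ => this i,
        Finset.prod_coe_sort (Finset.Icc 1 n) fun i => if i ∈ S.1 then r else 1,
        Finset.prod_ite_mem, Finset.inter_eq_right.2 hS, Finset.prod_const]
    have hF' : (∏ p : F, if ∃ a ∈ S.1, a ∈ I (Sum.inl p) then w (Sum.inl p) else 1) =
        ∏ p ∈ F, if ∃ i ∈ S.1, p.1 < i ∧ i < p.2 then N + 1 else 1 := by
      have : ∀ p : F, (if ∃ a ∈ S.1, a ∈ I (Sum.inl p) then w (Sum.inl p) else 1) =
          if ∃ i ∈ S.1, p.1.1 < i ∧ i < p.1.2 then N + 1 else 1 := fun p => by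
        simp [I, w]
      rw [Finset.prod_congr rfl fun p _ => this p]
      exact Finset.prod_coe_sort F fun p => if ∃ i ∈ S.1, p.1 < i ∧ i < p.2 then N + 1 else 1
    have hfl := ColorPoset.flagNumber_eq (n := n) (w := w) hI hIn hw S.1 hS
    rw [Fintype.prod_sum_type, hr', hF'] at hfl
    simp only [blockerVector, Pi.smul_apply, smul_eq_mul, flagVector]
    rw [hfl]
    push_cast
    rw [mul_comm (∏ p ∈ F, _) ((r : ℚ) ^ _), mul_left_comm]
    congr 1
    rw [← Finset.prod_const, ← Finset.prod_mul_distrib]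
    refine Finset.prod_congr rfl fun p _ => ?_
    split_ifs
    · field_simp
    · simp
  rw [heq]
  exact (thickCone r n).smul_mem (by positivity) hmem

theorem blockerVector_mem (n r : ℕ) (hr : 0 < r) (F : Finset (ℕ × ℕ))
    (hF : ∀ p ∈ F, p.2 ≤ n + 1) : blockerVector n r F 0 ∈ thickCone r n := by
  classical
  have hcont : Continuous (blockerVector n r F) := by
    refine continuous_pi fun S => continuous_const.mul (continuous_finsetProd _ fun p _ => ?_)
    exact continuous_const.if_const _ continuous_id
  have hlim : Filter.Tendsto (fun N : ℕ => blockerVector n r F (1 / ((N : ℚ) + 1))) Filter.atTop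
      (nhds (blockerVector n r F 0)) :=
    (hcont.tendsto 0).comp tendsto_one_div_add_atTop_nhds_zero_nat
  exact (isClosed_thickCone r n).mem_of_tendsto hlim
    (Filter.Eventually.of_forall fun N => blockerVector_mem_of_pos n r hr F hF N)

/-- A `ConvexCone` need not contain `0`, so the empty sum is excluded. -/
theorem sum_mem_of_nonempty {M ι : Type*} [AddCommGroup M] [Module ℚ M] (C : ConvexCone ℚ M)
    {s : Finset ι} (hs : s.Nonempty) (f : ι → M) (hf : ∀ i ∈ s, f i ∈ C) : ∑ i ∈ s, f i ∈ C := by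
  induction hs using Finset.Nonempty.cons_induction with
  | singleton a => simpa using hf a (by simp)
  | cons a s ha hs ih =>
    rw [Finset.sum_cons]
    exact C.add_mem (hf a (by simp)) (ih fun i hi => hf i (by simp [hi]))

/-! ### Rescaled flag vectors as sums of blocker vectors. -/

/-- The rescaled flag vector of a `q`-thick poset is a combination of blocker vectors. -/
theorem exists_flagNumber_eq_sum {P : Type} [PartialOrder P] [BoundedOrder P] [Finite P]
    [GradeMinOrder ℕ P] {q n : ℕ} (hq : 0 < q) (hP : IsThick q P)
    (htop : grade ℕ (⊤ : P) = n + 1) :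
    ∃ (A : Finset (ℕ → P)) (F : (ℕ → P) → Finset (ℕ × ℕ)), A.Nonempty ∧
      (∀ c, ∀ p ∈ F c, p.2 ≤ n + 1) ∧ ∀ r : ℕ,
        alpha n q r (flagVector n P) = (1 / (q : ℚ) ^ n) • ∑ c ∈ A, blockerVector n r (F c) 0 := by
  classical
  have := Fintype.ofFinite P
  obtain ⟨e, he⟩ : ∃ e : P → ℕ, Function.Injective e :=
    ⟨fun x => (Fintype.equivFin P x : ℕ), fun x y h => (Fintype.equivFin P).injective (Fin.ext h)⟩
  have hfin := finite_isRankChain (P := P) (Finset.range (n + 2))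
  let A := hfin.toFinset
  let F : (ℕ → P) → Finset (ℕ × ℕ) := fun c =>
    (Finset.range (n + 2) ×ˢ Finset.range (n + 2)).filter fun p => IsLate e q n c p.1 p.2
  have hF : ∀ c p, p ∈ F c ↔ IsLate e q n c p.1 p.2 := by
    intro c p
    simp only [F, Finset.mem_filter, Finset.mem_product, Finset.mem_range, and_iff_right_iff_imp]
    rintro ⟨h1, h2, -⟩
    omega
  have hcount : ∀ S ⊆ Finset.Icc 1 n,
      (A.filter fun c => ∀ p ∈ F c, ∃ i ∈ S, p.1 < i ∧ i < p.2).card =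
        q ^ (n - S.card) * flagNumber P S := by
    intro S hS
    have h1 := ncard_isEarlyChain he hP htop S hS n le_rfl
    rw [Finset.card_sdiff_of_subset hS, Nat.card_Icc, Nat.add_sub_cancel] at h1
    rw [← h1, ← Set.ncard_coe_finset]
    congr 1
    ext c
    simp only [Finset.coe_filter, Set.mem_ofPred_eq, isEarlyChain_iff e q n S hS c, A,
      Set.Finite.mem_toFinset]
    refine and_congr_right fun _ => ⟨fun h k m hkm => h (k, m) ((hF c (k, m)).2 hkm),
      fun h p hp => h p.1 p.2 ((hF c p).1 hp)⟩
  refine ⟨A, F, ?_, fun c p hp => ((hF c p).1 hp).2.1, fun r => ?_⟩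
  -- The count at `S = ∅`, where the only chain is empty, is `q ^ n > 0`, so a maximal chain exists.
  · have h0 : flagNumber P ∅ ≠ 0 := by
      have : {C : Set P | IsChain (· ≤ ·) C ∧ grade ℕ '' C = ((∅ : Finset ℕ) : Set ℕ)} = {∅} := by
        ext C
        simp only [Finset.coe_empty, Set.image_eq_empty, Set.mem_ofPred_eq, Set.mem_singleton_iff,
          and_iff_right_iff_imp]
        rintro rfl
        exact Set.subsingleton_empty.isChain
      rw [flagNumber, this, Set.ncard_singleton]
      exact one_ne_zero
    have h1 := hcount ∅ (Finset.empty_subset _)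
    have h2 : (A.filter fun c => ∀ p ∈ F c, ∃ i ∈ (∅ : Finset ℕ), p.1 < i ∧ i < p.2).Nonempty := by
      rw [← Finset.card_pos, h1]
      exact Nat.mul_pos (pow_pos hq _) (Nat.pos_of_ne_zero h0)
    exact h2.mono (Finset.filter_subset _ _)
  · funext S
    have hS : S.1 ⊆ Finset.Icc 1 n := Finset.mem_powerset.1 S.2
    have hSn : S.1.card ≤ n := by simpa using Finset.card_le_card hS
    have hq' : (q : ℚ) ≠ 0 := by positivity
    have hc : ((A.filter fun c => ∀ p ∈ F c, ∃ i ∈ S.1, p.1 < i ∧ i < p.2).card : ℚ) =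
        (q : ℚ) ^ (n - S.1.card) * flagNumber P S.1 := by
      exact_mod_cast hcount S.1 hS
    simp only [alpha, LinearMap.coe_mk, AddHom.coe_mk, Pi.smul_apply, Finset.sum_apply,
      blockerVector, smul_eq_mul, flagVector, Finset.prod_ite_zero, Finset.prod_const_one]
    rw [← Finset.mul_sum, Finset.sum_boole, hc, div_pow]
    -- Dividing the count by `q ^ n` leaves `q ^ (-|S|)`, precisely the denominator in `alpha`.
    have hpow : (q : ℚ) ^ n = q ^ S.1.card * q ^ (n - S.1.card) := by
      rw [← pow_add, Nat.add_sub_cancel' hSn]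
    rw [hpow]
    field_simp

/-- The preimage of a closed cone under a continuous linear map is a closed cone, so only the
generating flag vectors need checking. -/
theorem alpha_mem (n q r : ℕ) (hq : 0 < q) (hr : 0 < r) {v : FlagSpace n}
    (hv : v ∈ thickCone q n) : alpha n q r v ∈ thickCone r n := by
  have hcont : Continuous (alpha n q r) :=
    continuous_pi fun S => continuous_const.mul (continuous_apply S)
  refine ConvexCone.mem_sInf.1 hv ((thickCone r n).comap (alpha n q r))
    ⟨(isClosed_thickCone r n).preimage hcont, ?_⟩
  rintro _ ⟨P, _, _, _, _, htop, hP, rfl⟩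
  obtain ⟨A, F, hA, hF, h⟩ := exists_flagNumber_eq_sum hq hP htop
  change alpha n q r (flagVector n P) ∈ thickCone r n
  rw [h r]
  exact (thickCone r n).smul_mem (by positivity)
    (sum_mem_of_nonempty _ hA _ fun c _ => blockerVector_mem n r hr (F c) (hF c))

theorem alpha_alpha (n q r : ℕ) (hq : 0 < q) (hr : 0 < r) (v : FlagSpace n) :
    alpha n q r (alpha n r q v) = v := by
  funext S
  have hq' : (q : ℚ) ≠ 0 := by positivity
  have hr' : (r : ℚ) ≠ 0 := by positivity
  simp only [alpha, LinearMap.coe_mk, AddHom.coe_mk]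
  rw [← mul_assoc, ← mul_pow, div_mul_div_cancel₀ hq', div_self hr', one_pow, one_mul]

end FlagCone

theorem corollary3p2 (n q r : ℕ) (hq : 0 < q) (hr : 0 < r) :
    Function.Bijective (FlagCone.alpha n q r) ∧
      FlagCone.alpha n q r '' (FlagCone.thickCone q n : Set (FlagCone.FlagSpace n)) =
        (FlagCone.thickCone r n : Set (FlagCone.FlagSpace n)) := by
  refine ⟨Function.bijective_iff_has_inverse.2 ⟨FlagCone.alpha n r q,
    FlagCone.alpha_alpha n r q hr hq, FlagCone.alpha_alpha n q r hq hr⟩, ?_⟩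
  apply Set.Subset.antisymm
  · rintro _ ⟨v, hv, rfl⟩
    exact FlagCone.alpha_mem n q r hq hr hv
  · intro v hv
    exact ⟨FlagCone.alpha n r q v, FlagCone.alpha_mem n r q hr hq hv,
      FlagCone.alpha_alpha n q r hq hr v⟩
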